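/- Let $d \ge 1$ be an integer. A function $C : [0,1]^d \to [0,1]$ is a \emph{$d$-dimensional copula} if (i) $C(u) = 0$ whenever some coordinate of $u$ is $0$; (ii) $C(u) = u_k$ whenever all coordinates of $u$ other than the $k$-th equal $1$; and (iii) for all $a, b \in [0,1]^d$ with $a_i \le b_i$ for every $i$, $\sum_{s \subseteq \{1,\dots,d\}} (-1)^{|s|} C(c^{s}) \ge 0$, where $c^{s}_i = a_i$ for $i \in s$ and $c^{s}_i = b_i$ for $i \notin s$. It is a copula of a probability distribution $\mathbb{P}$ on $\mathbb{R}^d$, with marginal distribution functions $F_1, \dots, F_d$, if $\mathbb{P}(X_1 \le x_1, \dots, X_d \le x_d) = C(F_1(x_1), \dots, F_d(x_d))$ for all $x \in \mathbb{R}^d$, where $(X_1,\dots,X_d) \sim \mathbb{P}$. It is \emph{diagonally convex} if $u \mapsto C(u, \dots, u)$ is a convex function on $[0,1]$. \textbf{Lemma.} Let $\mu \in \mathbb{R}^d$ and let $\Sigma \in \mathbb{R}^{d \times d}$ be a symmetric, positive semi-definite matrix. Then the multivariate normal distribution $\mathcal{N}(\mu, \Sigma)$ with mean vector $\mu$ and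 covariance matrix $\Sigma$ has a diagonally convex copula; that is, there exists a $d$-dimensional copula $C$ which is a copula of $\mathcal{N}(\mu, \Sigma)$ and is diagonally convex. -/

import Mathlib

open MeasureTheory ProbabilityTheory

/-- The `C`-volume of the box `[a, b]`: the signed sum of the values of `C` at the vertices of the
box, where a vertex has sign `+1` if an even number of its coordinates are lower endpoints, and
`-1` otherwise. The vertex attached to `s` has coordinate `a i` for `i ∈ s` and `b i` otherwise. -/
noncomputable def boxVolume {d : ℕ} (C : (Fin d → ℝ) → ℝ) (a b : Fin d → ℝ) : ℝ :=
  ∑ s : Finset (Fin d), (-1 : ℝ) ^ s.card * C (fun i => if i ∈ s then a i else b i)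

/-- `C`, restricted to the unit cube `[0, 1]^d`, is a `d`-dimensional copula. Values of `C` outside
the unit cube play no role. -/
structure IsCopula {d : ℕ} (C : (Fin d → ℝ) → ℝ) : Prop where
  mem_Icc : ∀ u : Fin d → ℝ, (∀ i, u i ∈ Set.Icc (0 : ℝ) 1) → C u ∈ Set.Icc (0 : ℝ) 1
  /-- `C` vanishes when some coordinate is zero. -/
  grounded : ∀ u : Fin d → ℝ, (∀ i, u i ∈ Set.Icc (0 : ℝ) 1) → (∃ i, u i = 0) → C u = 0
  /-- When all coordinates but the `k`-th are equal to one, `C` returns the `k`-th coordinate. -/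
  margin : ∀ u : Fin d → ℝ, (∀ i, u i ∈ Set.Icc (0 : ℝ) 1) →
    ∀ k, (∀ i, i ≠ k → u i = 1) → C u = u k
  /-- Every box contained in the unit cube has nonnegative `C`-volume. -/
  increasing : ∀ a b : Fin d → ℝ, (∀ i, a i ∈ Set.Icc (0 : ℝ) 1) →
    (∀ i, b i ∈ Set.Icc (0 : ℝ) 1) → (∀ i, a i ≤ b i) → 0 ≤ boxVolume C a b

/-- `C` is a copula of the probability distribution `P` on `ℝ^d`: it is a copula, and the joint
distribution function of `P` is `x ↦ C (F₁ x₁, …, F_d x_d)`, where `F_i` is the distribution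
function of the `i`-th margin of `P`. -/
def IsCopulaOf {d : ℕ} (C : (Fin d → ℝ) → ℝ) (P : Measure (EuclideanSpace ℝ (Fin d)))
    [IsProbabilityMeasure P] : Prop :=
  IsCopula C ∧ ∀ x : Fin d → ℝ,
    P.real {y | ∀ i, y i ≤ x i} = C (fun i => cdf (P.map (fun y => y i)) (x i))

/-- The diagonal section of a copula. -/
def diagonalSection {d : ℕ} (C : (Fin d → ℝ) → ℝ) : ℝ → ℝ :=
  fun u => C (fun _ => u)

/-- The diagonal section `[0, 1] → [0, 1]` of `C` is a convex function. -/
def IsDiagonallyConvex {d : ℕ} (C : (Fin d → ℝ) → ℝ) : Prop :=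
  ConvexOn ℝ (Set.Icc (0 : ℝ) 1) (diagonalSection C)

open Set Filter Topology
open scoped RealInnerProductSpace ENNReal

/-! Realise the distribution as `μ + A x` with `x` standard Gaussian, and write row `i` of `A` as `σ
i • v i` with `v i` a unit vector. With Φ the standard normal distribution function, the joint law
of the uniform variables Φ(⟪v i, x⟫) is the copula. Its diagonal at `u` is the probability that
max_i Φ(⟪v i, x⟫) ≤ u. Split according to the first index `i` attaining the maximum. That event is
stable under translation along `v i`, because ⟪v j, v i⟫ ≤ 1 = ⟪v i, v i⟫, so its conditional
probability given ⟪v i, x⟫ = t is nondecreasing in `t` (`exists_monotone_stdGaussian_inter`). The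
diagonal is therefore the integral of a nondecreasing function up to the `u`-quantile, which is
convex (`convexOn_integral_cdf_le`). -/

lemma strictMono_cdf_gaussianReal : StrictMono (cdf (gaussianReal 0 1)) := by
  intro a b hab
  have hpos : 0 < gaussianReal 0 1 (Ioc a b) := by
    rw [pos_iff_ne_zero]
    intro h
    have := gaussianReal_absolutelyContinuous' 0 (one_ne_zero) h
    simp [Real.volume_Ioc] at this
    linarith
  rw [← measure_cdf (gaussianReal 0 1), StieltjesFunction.measure_Ioc] at hpos
  simpa using hpos

lemma continuous_cdf_of_nullSingleton (γ : Measure ℝ) [IsProbabilityMeasure γ]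
    (h : ∀ x, γ {x} = 0) : Continuous (cdf γ) := by
  rw [continuous_iff_continuousAt]
  intro x
  rw [(monotone_cdf γ).continuousAt_iff_leftLim_eq_rightLim, StieltjesFunction.rightLim_eq]
  have h' := h x
  rw [← measure_cdf γ, StieltjesFunction.measure_singleton, ENNReal.ofReal_eq_zero] at h'
  exact le_antisymm ((monotone_cdf γ).leftLim_le le_rfl) (by linarith)

lemma exists_cdf_gaussianReal_eq {u : ℝ} (h0 : 0 < u) (h1 : u < 1) :
    ∃ t, cdf (gaussianReal 0 1) t = u := by
  have hc : Continuous (cdf (gaussianReal 0 1)) :=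
    continuous_cdf_of_nullSingleton _ fun x => by
      have := nullSingletonClass_gaussianReal (μ := 0) (v := 1) one_ne_zero
      exact measure_singleton x
  obtain ⟨a, ha⟩ := ((tendsto_cdf_atBot (gaussianReal 0 1)).eventually (gt_mem_nhds h0)).exists
  obtain ⟨b, hb⟩ := ((tendsto_cdf_atTop (gaussianReal 0 1)).eventually (lt_mem_nhds h1)).exists
  exact mem_range_of_exists_le_of_exists_ge hc ⟨a, ha.le⟩ ⟨b, hb.le⟩

lemma cdf_gaussianReal_pos (t : ℝ) : 0 < cdf (gaussianReal 0 1) t :=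
  (cdf_nonneg _ _).trans_lt (strictMono_cdf_gaussianReal (sub_one_lt t))

lemma cdf_gaussianReal_lt_one (t : ℝ) : cdf (gaussianReal 0 1) t < 1 :=
  (strictMono_cdf_gaussianReal (lt_add_one t)).trans_le (cdf_le_one _ _)

lemma gaussianReal_cdf_le {u : ℝ} (hu : u ∈ Icc (0 : ℝ) 1) :
    (gaussianReal 0 1).real {t | cdf (gaussianReal 0 1) t ≤ u} = u := by
  rcases hu.1.eq_or_lt with rfl | h0
  · have : {t | cdf (gaussianReal 0 1) t ≤ 0} = ∅ :=
      eq_empty_of_forall_notMem fun t ht => (cdf_gaussianReal_pos t).not_ge ht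
    simp [this]
  rcases hu.2.eq_or_lt with rfl | h1
  · simp [cdf_le_one]
  obtain ⟨t, rfl⟩ := exists_cdf_gaussianReal_eq h0 h1
  have : {s | cdf (gaussianReal 0 1) s ≤ cdf (gaussianReal 0 1) t} = Iic t := by
    ext s; exact strictMono_cdf_gaussianReal.le_iff_le
  rw [this, cdf_eq_real]

lemma measurable_cdf (γ : Measure ℝ) : Measurable (cdf γ) := (monotone_cdf γ).measurable

/-- Integrating a nondecreasing function up to the `u`-quantile gives a convex function of `u`. -/
lemma convexOn_integral_cdf_le {h : ℝ → ℝ} (hm : Monotone h)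
    (hi : Integrable h (gaussianReal 0 1)) :
    ConvexOn ℝ (Icc (0 : ℝ) 1)
      (fun u => ∫ t in {t | cdf (gaussianReal 0 1) t ≤ u}, h t ∂(gaussianReal 0 1)) := by
  set γ := gaussianReal 0 1 with hγ
  have hS : ∀ u, MeasurableSet {t | cdf γ t ≤ u} := fun u =>
    measurableSet_le (measurable_cdf γ) measurable_const
  have hmeas : ∀ a b, MeasurableSet ({t | cdf γ t ≤ b} \ {t | cdf γ t ≤ a}) := fun a b =>
    (hS b).diff (hS a)
  have hsub : ∀ {a b : ℝ}, a ≤ b → {t | cdf γ t ≤ a} ⊆ {t | cdf γ t ≤ b} :=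
    fun hab t ht => le_trans (show cdf γ t ≤ _ from ht) hab
  have hvol : ∀ {a b : ℝ}, a ∈ Icc (0 : ℝ) 1 → b ∈ Icc (0 : ℝ) 1 → a ≤ b →
      γ.real ({t | cdf γ t ≤ b} \ {t | cdf γ t ≤ a}) = b - a := fun ha hb hab => by
    rw [measureReal_sdiff (hsub hab) (hS _), gaussianReal_cdf_le ha, gaussianReal_cdf_le hb]
  have hdiff : ∀ {a b : ℝ}, a ≤ b → ∫ t in {t | cdf γ t ≤ b} \ {t | cdf γ t ≤ a}, h t ∂γ =
      (∫ t in {t | cdf γ t ≤ b}, h t ∂γ) - ∫ t in {t | cdf γ t ≤ a}, h t ∂γ := fun {a b} hab =>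
    setIntegral_sdiff (hS a) hi.integrableOn (hsub hab)
  refine convexOn_of_slope_mono_adjacent (convex_Icc 0 1) ?_
  intro a b c ha hc hab hbc
  have hb : b ∈ Icc (0 : ℝ) 1 := ⟨ha.1.trans hab.le, hbc.le.trans hc.2⟩
  obtain ⟨t, rfl⟩ := exists_cdf_gaussianReal_eq (ha.1.trans_lt hab) (hbc.trans_le hc.2)
  rw [← hγ] at *
  rw [← hdiff hab.le, ← hdiff hbc.le]
  -- `t` is the `b`-quantile, so `h t` separates the averages of `h` over the two adjacent quantile
  -- intervals.
  trans h t
  · rw [div_le_iff₀ (sub_pos.2 hab), ← hvol ha hb hab.le, mul_comm, ← smul_eq_mul,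
      ← setIntegral_const]
    refine setIntegral_mono_on hi.integrableOn (integrable_const _).integrableOn (hmeas _ _) ?_
    intro s hs
    exact hm (strictMono_cdf_gaussianReal.le_iff_le.1 hs.1)
  · rw [le_div_iff₀ (sub_pos.2 hbc), ← hvol hb hc hbc.le, mul_comm, ← smul_eq_mul,
      ← setIntegral_const]
    refine setIntegral_mono_on (integrable_const _).integrableOn hi.integrableOn (hmeas _ _) ?_
    intro s hs
    exact hm (strictMono_cdf_gaussianReal.lt_iff_lt.1 (not_le.1 hs.2)).le

/-! ### Conditioning a standard Gaussian vector on one direction -/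

section StdGaussian

variable {E : Type*} [NormedAddCommGroup E] [InnerProductSpace ℝ E] [FiniteDimensional ℝ E]
  [MeasurableSpace E] [BorelSpace E]

lemma map_inner_stdGaussian {v : E} (hv : ‖v‖ = 1) :
    (stdGaussian E).map (fun x => ⟪v, x⟫) = gaussianReal 0 1 := by
  have h := IsGaussian.map_eq_gaussianReal (μ := stdGaussian E) (innerSL ℝ v)
  rw [integral_strongDual_stdGaussian, variance_dual_stdGaussian, innerSL_apply_norm, hv] at h
  simpa using h

/-- The pair is jointly Gaussian, so vanishing covariance suffices. -/
lemma indepFun_inner_sub_inner_smul {v : E} (hv : ‖v‖ = 1) :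
    IndepFun (fun x => ⟪v, x⟫) (fun x => x - ⟪v, x⟫ • v) (stdGaussian E) := by
  have hG : HasGaussianLaw (fun x : E => (⟪v, x⟫, x - ⟪v, x⟫ • v)) (stdGaussian E) := by
    have : (fun x : E => (⟪v, x⟫, x - ⟪v, x⟫ • v)) =
      ((innerSL ℝ v).prod (ContinuousLinearMap.id ℝ E - (innerSL ℝ v).smulRight v)) := by
      ext x <;> simp
    rw [this]
    exact ⟨inferInstance⟩
  refine hG.indepFun_of_covariance_inner fun s y => ?_
  have h1 : (fun x : E => ⟪s, ⟪v, x⟫⟫) = fun x => ⟪s • v, x⟫ := by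
    ext x; simp [real_inner_smul_left, mul_comm]
  have h2 : (fun x : E => ⟪y, x - ⟪v, x⟫ • v⟫) = fun x => ⟪y - ⟪y, v⟫ • v, x⟫ := by
    ext x
    simp [inner_sub_left, inner_sub_right, real_inner_smul_left, real_inner_smul_right, mul_comm]
  rw [h1, h2, ← covarianceBilin_apply_eq_cov IsGaussian.memLp_two_id, covarianceBilin_stdGaussian]
  rw [innerSL_apply_apply, real_inner_smul_left, inner_sub_right, real_inner_smul_right,
    real_inner_self_eq_norm_sq, hv, real_inner_comm y v]
  ring

/-- If a set `A` is stable under translation by nonnegative multiples of the unit vector `v`, then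
the conditional probability of `A` given `⟪v, x⟫ = t` is nondecreasing in `t`. -/
lemma exists_monotone_stdGaussian_inter {v : E} (hv : ‖v‖ = 1) {A : Set E} (hA : MeasurableSet A)
    (hAv : ∀ x ∈ A, ∀ t : ℝ, 0 ≤ t → x + t • v ∈ A) :
    ∃ h : ℝ → ℝ≥0∞, Monotone h ∧ (∀ t, h t ≤ 1) ∧ ∀ B : Set ℝ, MeasurableSet B →
      stdGaussian E (A ∩ (fun x => ⟪v, x⟫) ⁻¹' B) = ∫⁻ t in B, h t ∂(gaussianReal 0 1) := by
  set ν := (stdGaussian E).map (fun x => x - ⟪v, x⟫ • v) with hν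
  have hν' : IsProbabilityMeasure ν := Measure.isProbabilityMeasure_map (by fun_prop)
  have hmap : (stdGaussian E).map (fun x => (⟪v, x⟫, x - ⟪v, x⟫ • v)) =
      (gaussianReal 0 1).prod ν := by
    rw [(indepFun_iff_map_prod_eq_prod_map_map (by fun_prop) (by fun_prop)).1
      (indepFun_inner_sub_inner_smul hv), map_inner_stdGaussian hv]
  -- By independence, conditioning on ⟪v, x⟫ = t leaves the law `ν` of the orthogonal part
  -- unchanged.
  refine ⟨fun t => ν {w | w + t • v ∈ A}, ?_, fun t => prob_le_one, ?_⟩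
  · intro s t hst
    refine measure_mono fun w hw => ?_
    have := hAv _ hw (t - s) (sub_nonneg.2 hst)
    rwa [add_assoc, ← add_smul, add_sub_cancel] at this
  · intro B hB
    have hT : MeasurableSet {p : ℝ × E | p.1 ∈ B ∧ p.2 + p.1 • v ∈ A} :=
      (measurable_fst hB).inter ((by fun_prop : Measurable fun p : ℝ × E => p.2 + p.1 • v) hA)
    have heq : A ∩ (fun x => ⟪v, x⟫) ⁻¹' B =
        (fun x => (⟪v, x⟫, x - ⟪v, x⟫ • v)) ⁻¹' {p : ℝ × E | p.1 ∈ B ∧ p.2 + p.1 • v ∈ A} := by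
      ext x; simp [and_comm]
    rw [heq, ← Measure.map_apply (by fun_prop) hT, hmap, Measure.prod_apply hT,
      ← lintegral_indicator hB]
    refine lintegral_congr fun t => ?_
    by_cases ht : t ∈ B <;> simp [ht]

/-- Every finite family of reals has a first index at which its maximum is attained. -/
lemma exists_first_argmax {d : ℕ} (hd : 1 ≤ d) (z : Fin d → ℝ) :
    ∃ i, ∀ j, z j ≤ z i ∧ (j < i → z j < z i) := by
  have : Nonempty (Fin d) := ⟨⟨0, hd⟩⟩
  obtain ⟨m, hm⟩ := Finite.exists_max z
  obtain ⟨i, hi, hmin⟩ := WellFounded.has_min (wellFounded_lt (α := Fin d)) {i | ∀ j, z j ≤ z i}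
    ⟨m, hm⟩
  refine ⟨i, fun j => ⟨hi j, fun hji => lt_of_not_ge fun hij => hmin j ?_ hji⟩⟩
  exact fun k => (hi k).trans hij

lemma convexOn_stdGaussian_forall_cdf_le {d : ℕ} (hd : 1 ≤ d) {v : Fin d → E}
    (hv : ∀ i, ‖v i‖ = 1) :
    ConvexOn ℝ (Icc (0 : ℝ) 1) (fun u =>
      (stdGaussian E).real {x | ∀ i, cdf (gaussianReal 0 1) ⟪v i, x⟫ ≤ u}) := by
  -- Ties go to the smallest index, so the events are disjoint even when some `v i` coincide.
  set A : Fin d → Set E := fun i =>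
    {x | ∀ j, ⟪v j, x⟫ ≤ ⟪v i, x⟫ ∧ (j < i → ⟪v j, x⟫ < ⟪v i, x⟫)} with hA
  have hAm : ∀ i, MeasurableSet (A i) := fun i => by
    simp only [hA, ofPred_forall, ofPred_and]
    refine MeasurableSet.iInter fun j => (measurableSet_le (by fun_prop) (by fun_prop)).inter ?_
    by_cases hji : j < i
    · simpa [hji] using measurableSet_lt (by fun_prop) (by fun_prop)
    · simp [hji]
  have hAv : ∀ i, ∀ x ∈ A i, ∀ t : ℝ, 0 ≤ t → x + t • v i ∈ A i := fun i x hx t ht j => by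
    have h1 : ⟪v j, v i⟫ ≤ 1 := (real_inner_le_norm _ _).trans (by simp [hv])
    have h2 : ⟪v i, v i⟫ = 1 := by simp [hv]
    have h3 : t * ⟪v j, v i⟫ ≤ t := mul_le_of_le_one_right ht h1
    simp only [inner_add_right, real_inner_smul_right, h2, mul_one]
    exact ⟨add_le_add (hx j).1 h3, fun hji => add_lt_add_of_lt_of_le ((hx j).2 hji) h3⟩
  choose h hmono hle hint using fun i => exists_monotone_stdGaussian_inter (hv i) (hAm i) (hAv i)
  have hfin : ∀ i t, h i t ≠ ∞ := fun i t => ((hle i t).trans_lt ENNReal.one_lt_top).ne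
  have hmono' : ∀ i, Monotone fun t => (h i t).toReal := fun i s t hst =>
    ENNReal.toReal_mono (hfin i t) (hmono i hst)
  have hint' : ∀ i, Integrable (fun t => (h i t).toReal) (gaussianReal 0 1) := fun i =>
    Integrable.of_bound (hmono' i).measurable.aestronglyMeasurable 1 (ae_of_all _ fun t => by
      simpa using ENNReal.toReal_mono ENNReal.one_ne_top (hle i t))
  have hconv := convexOn_integral_cdf_le (h := fun t => ∑ i, (h i t).toReal)
    (fun s t hst => Finset.sum_le_sum fun i _ => hmono' i hst)
    (integrable_finsetSum _ fun i _ => hint' i)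
  refine hconv.congr fun u _ => ?_
  have hB : MeasurableSet {t | cdf (gaussianReal 0 1) t ≤ u} :=
    measurableSet_le (measurable_cdf _) measurable_const
  have hU : {x : E | ∀ i, cdf (gaussianReal 0 1) ⟪v i, x⟫ ≤ u} =
      ⋃ i, A i ∩ (fun x => ⟪v i, x⟫) ⁻¹' {t | cdf (gaussianReal 0 1) t ≤ u} := by
    ext x
    simp only [mem_ofPred_eq, mem_iUnion, mem_inter_iff, mem_preimage]
    constructor
    · intro hx
      obtain ⟨i, hi⟩ := exists_first_argmax hd fun j => ⟪v j, x⟫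
      exact ⟨i, hi, hx i⟩
    · rintro ⟨i, hi, hx⟩ j
      exact (monotone_cdf _ (hi j).1).trans hx
  have hdisj : Pairwise (Function.onFun Disjoint fun i =>
      A i ∩ (fun x => ⟪v i, x⟫) ⁻¹' {t | cdf (gaussianReal 0 1) t ≤ u}) := by
    intro i j hij
    refine Set.disjoint_left.2 fun x hxi hxj => ?_
    rcases hij.lt_or_gt with hlt | hlt
    · exact ((hxj.1 i).2 hlt).not_ge (hxi.1 j).1
    · exact ((hxi.1 j).2 hlt).not_ge (hxj.1 i).1
  dsimp only
  rw [hU, measureReal_def, measure_iUnion hdisj fun i =>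
      (hAm i).inter ((by fun_prop : Measurable fun x : E => ⟪v i, x⟫) hB),
    tsum_fintype, ENNReal.toReal_sum fun i _ => measure_ne_top _ _,
    integral_finsetSum _ fun i _ => (hint' i).integrableOn]
  refine Finset.sum_congr rfl fun i _ => ?_
  rw [hint i _ hB, integral_toReal (hmono i).measurable.aemeasurable
    (ae_of_all _ fun t => (hle i t).trans_lt ENNReal.one_lt_top)]

end StdGaussian

/-! ### Construction of the copula -/

/-- The distribution function of a random vector with uniform margins on `(0, 1)` is a copula. -/
lemma isCopula_measureReal_forall_le {Ω : Type*} [MeasurableSpace Ω] {P : Measure Ω}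
    [IsProbabilityMeasure P] {d : ℕ} {U : Fin d → Ω → ℝ} (hU : ∀ i, Measurable (U i))
    (hpos : ∀ i ω, 0 < U i ω) (hlt : ∀ i ω, U i ω < 1)
    (hunif : ∀ i, ∀ u ∈ Icc (0 : ℝ) 1, P.real {ω | U i ω ≤ u} = u) :
    IsCopula fun u => P.real {ω | ∀ i, U i ω ≤ u i} where
  mem_Icc u _ := ⟨measureReal_nonneg, measureReal_le_one⟩
  grounded u _ := by
    rintro ⟨i, hi⟩
    have : {ω | ∀ i, U i ω ≤ u i} = ∅ :=
      eq_empty_of_forall_notMem fun ω hω => (hpos i ω).not_ge (hi ▸ hω i)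
    simp [this]
  margin u hu k hk := by
    rw [← hunif k (u k) (hu k)]
    congr 1
    ext ω
    refine ⟨fun hω => hω k, fun hω i => ?_⟩
    by_cases hik : i = k
    · exact hik ▸ hω
    · exact hk i hik ▸ (hlt i ω).le
  increasing a b _ _ hab := by
    have hm : ∀ c : Fin d → ℝ, MeasurableSet {ω | ∀ i, U i ω ≤ c i} := fun c => by
      simp only [ofPred_forall]
      exact MeasurableSet.iInter fun i => measurableSet_le (hU i) measurable_const
    have hind : ∀ (c : Fin d → ℝ) ω, {ω | ∀ i, U i ω ≤ c i}.indicator (fun _ => (1 : ℝ)) ω =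
        ∏ i, if U i ω ≤ c i then (1 : ℝ) else 0 := fun c ω => by
      rw [Finset.prod_ite_zero]
      simp [indicator_apply]
    -- Inclusion–exclusion: expanding the product over subsets turns the box volume into the
    -- integral of a nonnegative product.
    have key : ∀ ω, ∑ s : Finset (Fin d), (-1 : ℝ) ^ s.card *
        {ω | ∀ i, U i ω ≤ if i ∈ s then a i else b i}.indicator (fun _ => (1 : ℝ)) ω =
        ∏ i, ((if U i ω ≤ b i then (1 : ℝ) else 0) - if U i ω ≤ a i then (1 : ℝ) else 0) := by
      intro ω
      rw [Finset.prod_sub, Finset.powerset_univ]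
      refine Finset.sum_congr rfl fun s _ => ?_
      rw [hind, mul_assoc, ← Finset.prod_sdiff (Finset.subset_univ s)]
      congr 2
      · exact Finset.prod_congr rfl fun i hi => by simp [(Finset.mem_sdiff.1 hi).2]
      · exact Finset.prod_congr rfl fun i hi => by simp [hi]
    have hsum : boxVolume (fun u => P.real {ω | ∀ i, U i ω ≤ u i}) a b =
        ∫ ω, ∏ i, ((if U i ω ≤ b i then (1 : ℝ) else 0) - if U i ω ≤ a i then (1 : ℝ) else 0)
          ∂P := by
      simp_rw [← key, boxVolume]
      rw [integral_finsetSum _ fun s _ =>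
        ((integrable_const _).indicator (hm _)).const_mul _]
      refine Finset.sum_congr rfl fun s _ => ?_
      rw [integral_const_mul, integral_indicator_const _ (hm _)]
      simp
    rw [hsum]
    refine integral_nonneg fun ω => Finset.prod_nonneg fun i _ => sub_nonneg.2 ?_
    by_cases h : U i ω ≤ a i
    · simp [h, h.trans (hab i)]
    · simp only [h, if_false]
      split_ifs <;> norm_num

/-- Allowing `w = 0` covers degenerate coordinates: a zero row still gets a direction, hence a
uniform variable. -/
lemma exists_unit_vector_smul_eq {E : Type*} [NormedAddCommGroup E] [NormedSpace ℝ E]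
    [Nontrivial E] (w : E) : ∃ v : E, ‖v‖ = 1 ∧ w = ‖w‖ • v := by
  by_cases hw : w = 0
  · obtain ⟨v, hv⟩ := exists_norm_eq E zero_le_one
    exact ⟨v, hv, by simp [hw]⟩
  · refine ⟨‖w‖⁻¹ • w, norm_smul_inv_norm hw, ?_⟩
    rw [smul_smul, mul_inv_cancel₀ (norm_ne_zero_iff.2 hw), one_smul]

/-- Comparing a scaled and translated standard normal variable with `x` is the same as comparing
the uniform variable it induces with the distribution function at `x`. -/
lemma cdf_gaussianReal_le_cdf_map_iff {m σ : ℝ} (hσ : 0 ≤ σ) (x z : ℝ) :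
    cdf (gaussianReal 0 1) z ≤ cdf ((gaussianReal 0 1).map fun z => m + σ * z) x ↔
      m + σ * z ≤ x := by
  have : IsProbabilityMeasure ((gaussianReal 0 1).map fun z => m + σ * z) :=
    Measure.isProbabilityMeasure_map (by fun_prop)
  rw [cdf_eq_real ((gaussianReal 0 1).map fun z => m + σ * z),
    map_measureReal_apply (by fun_prop) measurableSet_Iic]
  rcases hσ.eq_or_lt with rfl | hσ
  -- For a point mass the right-hand distribution function is 0 or 1, while Φ(z) lies strictly
  -- between.
  · by_cases h : m ≤ x
    · simp [h, cdf_le_one]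
    · simp [h, cdf_gaussianReal_pos]
  · have h : ∀ z, m + σ * z ≤ x ↔ z ≤ (x - m) / σ := fun z => by
      rw [le_div_iff₀ hσ, mul_comm z]; constructor <;> intro <;> linarith
    have : (fun z => m + σ * z) ⁻¹' Iic x = Iic ((x - m) / σ) := by
      ext z; exact h z
    rw [this, ← cdf_eq_real, strictMono_cdf_gaussianReal.le_iff_le, h]

/-- An affine image of a standard Gaussian vector has a diagonally convex copula. -/
lemma exists_diagonallyConvex_copula_of_map_stdGaussian {d : ℕ} (hd : 1 ≤ d)
    (μ : EuclideanSpace ℝ (Fin d)) (A : Matrix (Fin d) (Fin d) ℝ)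
    (P : Measure (EuclideanSpace ℝ (Fin d))) [IsProbabilityMeasure P]
    (hP : P = (stdGaussian (EuclideanSpace ℝ (Fin d))).map
      fun x => μ + Matrix.toEuclideanCLM (𝕜 := ℝ) A x) :
    ∃ C : (Fin d → ℝ) → ℝ, IsCopulaOf C P ∧ IsDiagonallyConvex C := by
  have : Nonempty (Fin d) := ⟨⟨0, hd⟩⟩
  choose v hv hvT using fun i => exists_unit_vector_smul_eq
    ((WithLp.toLp 2 (A i) : EuclideanSpace ℝ (Fin d)))
  set σ : Fin d → ℝ := fun i => ‖(WithLp.toLp 2 (A i) : EuclideanSpace ℝ (Fin d))‖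
  have hrow : ∀ i x, (μ + Matrix.toEuclideanCLM (𝕜 := ℝ) A x) i = μ i + σ i * ⟪v i, x⟫ := fun i x => by
    rw [← real_inner_smul_left, ← hvT i]
    simp [PiLp.inner_apply, Matrix.mulVec, dotProduct, mul_comm]
  have hmarg : ∀ i, (P).map (fun y => y i) =
      (gaussianReal 0 1).map fun z => μ i + σ i * z := fun i => by
    rw [hP, Measure.map_map (by fun_prop) (by fun_prop), ← map_inner_stdGaussian (hv i),
      Measure.map_map (by fun_prop) (by fun_prop)]
    congr 1
    ext x
    exact hrow i x
  have hU : ∀ i, Measurable fun x => cdf (gaussianReal 0 1) ⟪v i, x⟫ := fun i =>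
    (measurable_cdf _).comp (by fun_prop)
  refine ⟨fun u => (stdGaussian (EuclideanSpace ℝ (Fin d))).real
    {x | ∀ i, cdf (gaussianReal 0 1) ⟪v i, x⟫ ≤ u i}, ⟨?_, fun x => ?_⟩,
    convexOn_stdGaussian_forall_cdf_le hd hv⟩
  · refine isCopula_measureReal_forall_le hU (fun i x => cdf_gaussianReal_pos _)
      (fun i x => cdf_gaussianReal_lt_one _) fun i u hu => ?_
    have h := gaussianReal_cdf_le hu
    rwa [← map_inner_stdGaussian (hv i), map_measureReal_apply (by fun_prop)
      (measurableSet_le (measurable_cdf _) measurable_const), map_inner_stdGaussian (hv i)] at h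
  · have hm : MeasurableSet {y : EuclideanSpace ℝ (Fin d) | ∀ i, y i ≤ x i} := by
      simp only [ofPred_forall]
      exact MeasurableSet.iInter fun i => measurableSet_le (by fun_prop) measurable_const
    trans (stdGaussian (EuclideanSpace ℝ (Fin d))).real {y | ∀ i, μ i + σ i * ⟪v i, y⟫ ≤ x i}
    · rw [hP, map_measureReal_apply (by fun_prop) hm]
      simp only [preimage_ofPred_eq, hrow]
    · congr 1
      ext y
      refine forall_congr' fun i => ?_
      beta_reduce
      rw [hmarg i, cdf_gaussianReal_le_cdf_map_iff (norm_nonneg _)]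

theorem mainTheorem3 (d : ℕ) (hd : 1 ≤ d) (μ : EuclideanSpace ℝ (Fin d))
    (S : Matrix (Fin d) (Fin d) ℝ) (hS : S.PosSemidef) :
    ∃ C : (Fin d → ℝ) → ℝ,
      IsCopulaOf C (multivariateGaussian μ S) ∧ IsDiagonallyConvex C :=
  -- `multivariateGaussian` is by definition such an affine image; `rfl` determines the matrix.
  exists_diagonallyConvex_copula_of_map_stdGaussian hd μ _ _ rfl
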